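/- Let $d\ge 2$ be an integer and let $p\in[0,1]$. Let $((\mathcal T_n,\sigma_n))_{n\ge 1}$ be the random sequence of coloured rooted trees grown as follows. $\mathcal T_1$ consists of a single vertex, the root, which is coloured red or blue with probability $1/2$ each. For $n\ge 1$, given $(\mathcal T_n,\sigma_n)$, a vertex $v$ of $\mathcal T_n$ is chosen with probability $$\frac{\alpha\deg^+(v)+1}{\sum_{u\in V(\mathcal T_n)}(\alpha\deg^+(u)+1)},\qquad \alpha=-\frac1d,$$ where $\deg^+(u)$ is the number of children of $u$ in $\mathcal T_n$; the tree $\mathcal T_{n+1}$ is obtained by adding a new child to $v$. The new vertex takes the colour of $v$ with probability $p$ and the other colour with probability $1-p$, and all other vertices keep their colours. Let $\mathcal C_n$ be the root cluster of $(\mathcal T_n,\sigma_n)$, that is, the maximal monochromatic subtree containing the root, and let $|\mathcal C_n|$ be its number of vertices. Then for every integer $k\ge 1$, $$\mathbb P\Big(\lim_{n\to\infty}|\mathcal C_n|=k\Big)=\frac1k\binom{kd}{k-1}p^{k-1}(1-p)^{kd-k+1}.$$ In particular, if $p\le 1/d$, then almost surely $\lim_{n\to\infty}|\mathcal C_n|$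 is finite, i.e. the root cluster is almost surely finite. -/

import Mathlib

open MeasureTheory Filter Topology

namespace BroadcastTree

/-!
Vertices are labelled by their time of arrival: the root is `0`, and for `n ≥ 1` the tree `T n` has
the vertex set `{0, …, n - 1}`.  A growing tree is encoded by `par : ℕ → ℕ`, where `par u` is the
parent of the vertex `u ≥ 1` (the value `par 0` is never used), and a colouring by
`col : ℕ → Bool` (`true` is red, `false` is blue).
-/

/-- The outdegree (number of children) of the vertex `v` in the tree `T n`. -/
def outdeg (par : ℕ → ℕ) (n v : ℕ) : ℕ :=
  ((Finset.Ico 1 n).filter fun u => par u = v).card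

/-- The probability that the vertex `v` of `T n` is chosen as the parent of the next vertex `n`,
under linear preferential attachment with parameter `α`. -/
noncomputable def attachProb (α : ℝ) (par : ℕ → ℕ) (n v : ℕ) : ℝ :=
  (α * (outdeg par n v : ℝ) + 1) / ∑ u ∈ Finset.range n, (α * (outdeg par n u : ℝ) + 1)

/-- The tree `T n` as a graph: each `u` with `1 ≤ u < n` is joined to its parent `par u`
(the labels `≥ n`, which are not vertices of `T n`, are left isolated). -/
def treeGraph (par : ℕ → ℕ) (n : ℕ) : SimpleGraph ℕ :=
  SimpleGraph.fromRel fun u v => 1 ≤ u ∧ u < n ∧ par u = v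

/-- The graph obtained from `T n` by removing the edges between vertices of different colours. -/
def monoGraph (par : ℕ → ℕ) (col : ℕ → Bool) (n : ℕ) : SimpleGraph ℕ where
  Adj u v := (treeGraph par n).Adj u v ∧ col u = col v
  symm := ⟨fun _ _ h => ⟨h.1.symm, h.2.symm⟩⟩
  loopless := ⟨fun _ h => h.1.ne rfl⟩

/-- The root cluster of `T n`: the vertex set of the maximal monochromatic subtree containing the
root. -/
def rootCluster (par : ℕ → ℕ) (col : ℕ → Bool) (n : ℕ) : Set ℕ :=
  {v | (monoGraph par col n).Reachable 0 v}

/-- The event that `T n` with its colouring is the one encoded by `a` and `c`. -/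
def stateEvent {Ω : Type*} (par : ℕ → Ω → ℕ) (col : ℕ → Ω → Bool) (n : ℕ)
    (a : ℕ → ℕ) (c : ℕ → Bool) : Set Ω :=
  {ω | (∀ i, 1 ≤ i → i < n → par i ω = a i) ∧ ∀ i, i < n → col i ω = c i}

/-- `(par, col)` is a random sequence of growing preferential attachment trees with parameter `α`,
with consistent broadcasting induced colourings with parameter `p`: the colour of the root is
uniform, and given the coloured tree `T n` (which determines all the earlier ones), the vertex `n`
becomes a child of the vertex `v` with probability `attachProb α _ n v`, and then takes the colour
of `v` with probability `p` and the other colour with probability `1 - p`. -/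
structure IsBroadcastProcess {Ω : Type*} [MeasurableSpace Ω] (μ : Measure Ω) (α p : ℝ)
    (par : ℕ → Ω → ℕ) (col : ℕ → Ω → Bool) : Prop where
  measurable_par : ∀ n, Measurable (par n)
  measurable_col : ∀ n, Measurable (col n)
  par_lt : ∀ n, 1 ≤ n → ∀ ω, par n ω < n
  root_col : ∀ b : Bool, μ.real {ω | col 0 ω = b} = 1 / 2
  step : ∀ n, 1 ≤ n → ∀ (a : ℕ → ℕ) (c : ℕ → Bool), a n < n →
    μ.real (stateEvent par col (n + 1) a c) =
      μ.real (stateEvent par col n a c) *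
        (attachProb α a n (a n) * if c n = c (a n) then p else 1 - p)

end BroadcastTree

namespace BroadcastTree

/-! ### The root cluster along one realisation of the tree -/

/-! Let `K` be the size of the root cluster and `D` the number of children, of either colour, of its
vertices. For `α = -1/d` the cluster is selected with probability `(dK - D) / ((d - 1)n + 1)`; a
selection raises `D` by one and, with probability `p`, also `K`. So the number `dK - D` of free
places is a lazy random walk started at `d`, with steps `d - 1` (probability `p`) and `-1`
(probability `1 - p`), frozen at `0`. It stays nonnegative because a vertex with `d` children is
almost surely never chosen (`ae_clusterChildren_le`).

Freezing with `k` vertices means reaching `0` with `k - 1` up-steps among `kd` steps, and the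
ballot-type count of such paths gives the formula. This is carried out through a bounded martingale:
`absorbProb` is harmonic for the walk (`absorbProb_eq`, `stepMean_absorbProb`) and its boundary
value at `D = dK` is `1` if `K = k` and `0` otherwise. The walk cannot stall at a positive level,
since it moves at time `n` with probability at least `1/(dn)` and the harmonic series diverges
(`measure_forall_eq`). Hence the martingale converges to the indicator of the event, and dominated
convergence identifies the probability with the value at `K = 1`, `D = 0`.

If `pd ≤ 1`, the free places form a nonnegative supermartingale, which converges; each growth of the
cluster moves it by `d - 1 ≥ 1`, so growth stops. -/

/-- The root cluster of `T n`, built recursively: a new vertex joins it when its parent is in it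
and has the same colour. -/
def cluster (a : ℕ → ℕ) (c : ℕ → Bool) : ℕ → Finset ℕ
  | 0 => {0}
  | n + 1 =>
    if 1 ≤ n ∧ a n ∈ cluster a c n ∧ c n = c (a n) then insert n (cluster a c n)
    else cluster a c n

/-- The total number of children, of either colour, of the vertices of the root cluster. -/
def clusterDeg (a : ℕ → ℕ) (c : ℕ → Bool) (n : ℕ) : ℕ :=
  ∑ v ∈ cluster a c n, outdeg a n v

lemma cluster_subset_succ (a : ℕ → ℕ) (c : ℕ → Bool) (n : ℕ) :
    cluster a c n ⊆ cluster a c (n + 1) := by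
  rw [cluster]
  split_ifs
  · exact Finset.subset_insert _ _
  · exact subset_rfl

lemma cluster_mono (a : ℕ → ℕ) (c : ℕ → Bool) : Monotone (cluster a c) :=
  monotone_nat_of_le_succ (cluster_subset_succ a c)

lemma zero_mem_cluster (a : ℕ → ℕ) (c : ℕ → Bool) (n : ℕ) : 0 ∈ cluster a c n :=
  cluster_mono a c (Nat.zero_le n) (by simp [cluster])

lemma lt_of_mem_cluster {a : ℕ → ℕ} {c : ℕ → Bool} {n v : ℕ} (hv : v ∈ cluster a c n)
    (hv0 : v ≠ 0) : v < n := by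
  induction n with
  | zero => simp [cluster] at hv; exact absurd hv hv0
  | succ n ih =>
    rw [cluster] at hv
    split_ifs at hv
    · rcases Finset.mem_insert.1 hv with rfl | hv
      · omega
      · exact (ih hv).trans (Nat.lt_succ_self n)
    · exact (ih hv).trans (Nat.lt_succ_self n)

lemma cluster_subset_range {a : ℕ → ℕ} {c : ℕ → Bool} {n : ℕ} (hn : 1 ≤ n) :
    cluster a c n ⊆ Finset.range n := by
  intro v hv
  rcases eq_or_ne v 0 with rfl | hv0
  · exact Finset.mem_range.2 hn
  · exact Finset.mem_range.2 (lt_of_mem_cluster hv hv0)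

lemma self_notMem_cluster {a : ℕ → ℕ} {c : ℕ → Bool} {n : ℕ} (hn : 1 ≤ n) :
    n ∉ cluster a c n := fun h =>
  (lt_of_mem_cluster h (by omega)).false

lemma mem_cluster_succ_iff {a : ℕ → ℕ} {c : ℕ → Bool} {n v : ℕ} (h : v ≠ n) :
    v ∈ cluster a c (n + 1) ↔ v ∈ cluster a c n := by
  rw [cluster]
  split_ifs <;> simp [h]

/-- Membership of a vertex is settled on its arrival, when its parent's status is already final.
This makes the recursive cluster closed under adjacency in `monoGraph`. -/
lemma mem_cluster_iff_parent {a : ℕ → ℕ} {c : ℕ → Bool} (ha : ∀ i, 1 ≤ i → a i < i) {n u : ℕ}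
    (hu : 1 ≤ u) (hun : u < n) :
    u ∈ cluster a c n ↔ a u ∈ cluster a c n ∧ c u = c (a u) := by
  induction n with
  | zero => omega
  | succ n ih =>
    have hau := ha u hu
    rw [mem_cluster_succ_iff (v := a u) (by omega)]
    rcases Nat.lt_succ_iff_lt_or_eq.1 hun with h | rfl
    · rw [mem_cluster_succ_iff h.ne, ih h]
    · rw [cluster]
      have := self_notMem_cluster (a := a) (c := c) hu
      split_ifs with h1 <;> simp_all

lemma mem_cluster_of_adj {a : ℕ → ℕ} {c : ℕ → Bool} (ha : ∀ i, 1 ≤ i → a i < i) {n u v : ℕ}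
    (hu : u ∈ cluster a c n) (huv : (monoGraph a c n).Adj u v) : v ∈ cluster a c n := by
  obtain ⟨h, hc⟩ := huv
  rw [treeGraph, SimpleGraph.fromRel_adj] at h
  rcases h.2 with ⟨h1, h2, rfl⟩ | ⟨h1, h2, rfl⟩
  · exact ((mem_cluster_iff_parent ha h1 h2).1 hu).1
  · exact (mem_cluster_iff_parent ha h1 h2).2 ⟨hu, hc.symm⟩

lemma monoGraph_mono (a : ℕ → ℕ) (c : ℕ → Bool) (n : ℕ) :
    monoGraph a c n ≤ monoGraph a c (n + 1) := by
  intro u v h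
  refine ⟨?_, h.2⟩
  have h1 := h.1
  rw [treeGraph, SimpleGraph.fromRel_adj] at h1 ⊢
  refine ⟨h1.1, h1.2.imp ?_ ?_⟩ <;> rintro ⟨h1, h2, h3⟩ <;>
    exact ⟨h1, h2.trans (Nat.lt_succ_self n), h3⟩

lemma reachable_of_mem_cluster {a : ℕ → ℕ} {c : ℕ → Bool} (ha : ∀ i, 1 ≤ i → a i < i) {n v : ℕ}
    (hv : v ∈ cluster a c n) : (monoGraph a c n).Reachable 0 v := by
  induction n generalizing v with
  | zero =>
    simp only [cluster, Finset.mem_singleton] at hv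
    rw [hv]
  | succ n ih =>
    rcases eq_or_ne v n with rfl | hvn
    · rcases Nat.eq_zero_or_pos v with rfl | hv1
      · rfl
      · have h := (mem_cluster_iff_parent ha hv1 (Nat.lt_succ_self v)).1 hv
        have hav := ha v hv1
        rw [mem_cluster_succ_iff hav.ne] at h
        refine ((ih h.1).mono (monoGraph_mono a c v)).trans
          (SimpleGraph.Adj.reachable ⟨?_, h.2.symm⟩)
        rw [treeGraph, SimpleGraph.fromRel_adj]
        exact ⟨hav.ne, Or.inr ⟨hv1, Nat.lt_succ_self v, rfl⟩⟩
    · exact (ih ((mem_cluster_succ_iff hvn).1 hv)).mono (monoGraph_mono a c n)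

lemma rootCluster_eq_cluster {a : ℕ → ℕ} {c : ℕ → Bool} (ha : ∀ i, 1 ≤ i → a i < i) (n : ℕ) :
    rootCluster a c n = cluster a c n := by
  ext v
  refine ⟨fun h => ?_, fun h => reachable_of_mem_cluster ha h⟩
  obtain ⟨w⟩ := (show (monoGraph a c n).Reachable 0 v from h)
  have key : ∀ {u v : ℕ}, (monoGraph a c n).Walk u v → u ∈ cluster a c n → v ∈ cluster a c n := by
    intro u v w
    induction w with
    | nil => exact id
    | cons h _ ih => exact fun hu => ih (mem_cluster_of_adj ha hu h)
  exact key w (zero_mem_cluster a c n)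

lemma ncard_rootCluster {a : ℕ → ℕ} {c : ℕ → Bool} (ha : ∀ i, 1 ≤ i → a i < i) (n : ℕ) :
    (rootCluster a c n).ncard = (cluster a c n).card := by
  rw [rootCluster_eq_cluster ha, Set.ncard_coe_finset]

/-! ### Outdegrees, and one-step changes of the cluster's size and total degree -/

lemma outdeg_congr {a a' : ℕ → ℕ} {n : ℕ} (ha : ∀ i, 1 ≤ i → i < n → a i = a' i) (v : ℕ) :
    outdeg a n v = outdeg a' n v := by
  unfold outdeg
  congr 1
  refine Finset.filter_congr fun u hu => ?_
  rw [Finset.mem_Ico] at hu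
  rw [ha u hu.1 hu.2]

lemma outdeg_succ (a : ℕ → ℕ) {n : ℕ} (hn : 1 ≤ n) (v : ℕ) :
    outdeg a (n + 1) v = outdeg a n v + if a n = v then 1 else 0 := by
  unfold outdeg
  rw [Finset.card_filter, Finset.card_filter, Finset.sum_Ico_succ_top hn]

lemma outdeg_of_le {a : ℕ → ℕ} (ha : ∀ i, 1 ≤ i → a i < i) {n v : ℕ} (h : n ≤ v + 1) :
    outdeg a n v = 0 := by
  unfold outdeg
  rw [Finset.card_eq_zero, Finset.filter_eq_empty_iff]
  intro u hu
  rw [Finset.mem_Ico] at hu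
  have := ha u hu.1
  omega

lemma sum_outdeg {a : ℕ → ℕ} (ha : ∀ i, 1 ≤ i → a i < i) (n : ℕ) :
    ∑ v ∈ Finset.range n, outdeg a n v = n - 1 := by
  unfold outdeg
  rw [← Finset.card_eq_sum_card_fiberwise, Nat.card_Ico]
  intro u hu
  simp only [Finset.coe_Ico, Set.mem_Ico, Finset.coe_range, Set.mem_Iio] at hu ⊢
  exact (ha u hu.1).trans hu.2

lemma cluster_congr {a a' : ℕ → ℕ} {c c' : ℕ → Bool} (haa : ∀ i, 1 ≤ i → a i < i) {n : ℕ}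
    (ha : ∀ i, 1 ≤ i → i < n → a i = a' i) (hc : ∀ i, i < n → c i = c' i) :
    cluster a c n = cluster a' c' n := by
  induction n with
  | zero => rfl
  | succ n ih =>
    rw [cluster, cluster, ih (fun i h1 h2 => ha i h1 (by omega)) (fun i h => hc i (by omega))]
    by_cases hn : 1 ≤ n
    · have h := haa n hn
      rw [ha n hn (by omega)] at h ⊢
      rw [hc n (by omega), hc (a' n) (by omega)]
    · simp [hn]

lemma clusterDeg_congr {a a' : ℕ → ℕ} {c c' : ℕ → Bool} (haa : ∀ i, 1 ≤ i → a i < i) {n : ℕ}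
    (ha : ∀ i, 1 ≤ i → i < n → a i = a' i) (hc : ∀ i, i < n → c i = c' i) :
    clusterDeg a c n = clusterDeg a' c' n := by
  unfold clusterDeg
  rw [cluster_congr haa ha hc]
  exact Finset.sum_congr rfl fun v _ => outdeg_congr ha v

lemma cluster_one (a : ℕ → ℕ) (c : ℕ → Bool) : cluster a c 1 = {0} := by
  simp [cluster]

lemma clusterDeg_one (a : ℕ → ℕ) (c : ℕ → Bool) : clusterDeg a c 1 = 0 := by
  simp [clusterDeg, cluster_one, outdeg]

lemma sum_outdeg_succ {a : ℕ → ℕ} {n : ℕ} (hn : 1 ≤ n) (s : Finset ℕ) :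
    ∑ v ∈ s, outdeg a (n + 1) v = ∑ v ∈ s, outdeg a n v + if a n ∈ s then 1 else 0 := by
  simp_rw [outdeg_succ a hn, Finset.sum_add_distrib, Finset.sum_ite_eq]

lemma clusterDeg_succ {a : ℕ → ℕ} {c : ℕ → Bool} (ha : ∀ i, 1 ≤ i → a i < i) {n : ℕ}
    (hn : 1 ≤ n) :
    clusterDeg a c (n + 1) = clusterDeg a c n + if a n ∈ cluster a c n then 1 else 0 := by
  unfold clusterDeg
  rw [← sum_outdeg_succ hn, cluster]
  split_ifs with h
  · rw [Finset.sum_insert (self_notMem_cluster hn), outdeg_of_le ha le_rfl, zero_add]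
  · rfl

lemma card_cluster_succ {a : ℕ → ℕ} {c : ℕ → Bool} {n : ℕ} (hn : 1 ≤ n) :
    (cluster a c (n + 1)).card =
      (cluster a c n).card + if a n ∈ cluster a c n ∧ c n = c (a n) then 1 else 0 := by
  rw [cluster]
  simp only [hn, true_and]
  split_ifs with h
  · rw [Finset.card_insert_of_notMem (self_notMem_cluster hn)]
  · rfl

lemma card_cluster_mono (a : ℕ → ℕ) (c : ℕ → Bool) : Monotone fun n => (cluster a c n).card :=
  fun _ _ h => Finset.card_le_card (cluster_mono a c h)

lemma card_cluster_le {a : ℕ → ℕ} {c : ℕ → Bool} {n : ℕ} (hn : 1 ≤ n) :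
    (cluster a c n).card ≤ n := by
  simpa using Finset.card_le_card (cluster_subset_range (a := a) (c := c) hn)

lemma clusterDeg_le {a : ℕ → ℕ} {c : ℕ → Bool} (ha : ∀ i, 1 ≤ i → a i < i) {n : ℕ} (hn : 1 ≤ n) :
    clusterDeg a c n ≤ n :=
  (Finset.sum_le_sum_of_subset (cluster_subset_range hn)).trans
    ((sum_outdeg ha n).le.trans (Nat.sub_le n 1))

/-! ### Attachment probabilities for `α = -1/d` -/

/-- The weight of the root cluster among all vertices, for the parameter `α = -1 / d`. -/
noncomputable def rate (d n K D : ℕ) : ℝ :=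
  ((d : ℝ) * K - D) / ((d : ℝ) * n - n + 1)

lemma rate_den_pos {d : ℕ} (hd : 1 ≤ d) (n : ℕ) : (0 : ℝ) < (d : ℝ) * n - n + 1 := by
  have : (1 : ℝ) ≤ d := by exact_mod_cast hd
  nlinarith [(Nat.cast_nonneg n : (0 : ℝ) ≤ n)]

/-- The outdegrees sum to `n - 1`, so the total weight `n - (n - 1)/d` does not depend on the shape
of the tree. -/
lemma attachProb_eq {d : ℕ} (hd : 1 ≤ d) {a : ℕ → ℕ} (ha : ∀ i, 1 ≤ i → a i < i) {n : ℕ}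
    (hn : 1 ≤ n) (v : ℕ) :
    attachProb (-1 / (d : ℝ)) a n v = ((d : ℝ) - outdeg a n v) / ((d : ℝ) * n - n + 1) := by
  unfold attachProb
  have h1 := rate_den_pos hd n
  have hd0 : (d : ℝ) ≠ 0 := by positivity
  have h2 : ∑ u ∈ Finset.range n, (-1 / (d : ℝ) * (outdeg a n u : ℝ) + 1) =
      ((d : ℝ) * n - n + 1) / d := by
    rw [Finset.sum_add_distrib, ← Finset.mul_sum, ← Nat.cast_sum, sum_outdeg ha]
    push_cast [hn]
    simp
    field_simp
    ring
  rw [h2]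
  field_simp
  ring

lemma sum_attachProb_cluster {d : ℕ} (hd : 1 ≤ d) {a : ℕ → ℕ} (c : ℕ → Bool)
    (ha : ∀ i, 1 ≤ i → a i < i) {n : ℕ} (hn : 1 ≤ n) :
    ∑ v ∈ cluster a c n, attachProb (-1 / (d : ℝ)) a n v =
      rate d n (cluster a c n).card (clusterDeg a c n) := by
  simp_rw [attachProb_eq hd ha hn, ← Finset.sum_div, Finset.sum_sub_distrib, rate, clusterDeg]
  simp [mul_comm]

lemma sum_attachProb_range {d : ℕ} (hd : 1 ≤ d) {a : ℕ → ℕ}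
    (ha : ∀ i, 1 ≤ i → a i < i) {n : ℕ} (hn : 1 ≤ n) :
    ∑ v ∈ Finset.range n, attachProb (-1 / (d : ℝ)) a n v = 1 := by
  simp_rw [attachProb_eq hd ha hn, ← Finset.sum_div, Finset.sum_sub_distrib, ← Nat.cast_sum,
    sum_outdeg ha]
  rw [div_eq_one_iff_eq (rate_den_pos hd n).ne']
  push_cast [hn]
  simp
  ring

/-- The expected value after one step of a function of the size and total degree of the root
cluster, given the current values `K` and `D`. -/
noncomputable def stepMean (d : ℕ) (p : ℝ) (F : ℕ → ℕ → ℝ) (n K D : ℕ) : ℝ :=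
  F K D + rate d n K D * (p * F (K + 1) (D + 1) + (1 - p) * F K (D + 1) - F K D)

/-- A parent outside the cluster changes neither coordinate, and the weights inside it sum to
`rate`. So the transition depends on the coloured tree only through size and total degree. -/
lemma sum_step_eq_stepMean {d : ℕ} (hd : 1 ≤ d) (p : ℝ) {a : ℕ → ℕ} {c : ℕ → Bool}
    (ha : ∀ i, 1 ≤ i → a i < i) {n : ℕ} (hn : 1 ≤ n) (F : ℕ → ℕ → ℝ) :
    ∑ x ∈ Finset.range n ×ˢ (Finset.univ : Finset Bool),
      attachProb (-1 / (d : ℝ)) a n x.1 * (if x.2 = c x.1 then p else 1 - p) *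
        F (cluster (Function.update a n x.1) (Function.update c n x.2) (n + 1)).card
          (clusterDeg (Function.update a n x.1) (Function.update c n x.2) (n + 1)) =
      stepMean d p F n (cluster a c n).card (clusterDeg a c n) := by
  set K := (cluster a c n).card with hK
  set D := clusterDeg a c n with hD
  have hterm : ∀ v ∈ Finset.range n, ∑ b : Bool,
      attachProb (-1 / (d : ℝ)) a n v * (if b = c v then p else 1 - p) *
        F (cluster (Function.update a n v) (Function.update c n b) (n + 1)).card
          (clusterDeg (Function.update a n v) (Function.update c n b) (n + 1)) =
      attachProb (-1 / (d : ℝ)) a n v * F K D +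
        if v ∈ cluster a c n then attachProb (-1 / (d : ℝ)) a n v *
          (p * F (K + 1) (D + 1) + (1 - p) * F K (D + 1) - F K D) else 0 := by
    intro v hv
    rw [Finset.mem_range] at hv
    have hb : ∀ b : Bool,
        (cluster (Function.update a n v) (Function.update c n b) (n + 1)).card =
          K + (if v ∈ cluster a c n ∧ b = c v then 1 else 0) ∧
        clusterDeg (Function.update a n v) (Function.update c n b) (n + 1) =
          D + if v ∈ cluster a c n then 1 else 0 := by
      intro b
      have hu : ∀ i, 1 ≤ i → Function.update a n v i < i := by
        intro i hi
        rcases eq_or_ne i n with rfl | h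
        · simpa using hv
        · simpa [h] using ha i hi
      have h1 : ∀ i, 1 ≤ i → i < n → Function.update a n v i = a i := fun i _ h => by
        simp [h.ne]
      have h2 : ∀ i, i < n → Function.update c n b i = c i := fun i h => by
        simp [h.ne]
      rw [card_cluster_succ hn, clusterDeg_succ hu hn, cluster_congr hu h1 h2,
        clusterDeg_congr hu h1 h2]
      simp [hv.ne, hK, hD]
    simp_rw [hb]
    by_cases hvc : v ∈ cluster a c n
    · cases hcv : c v <;> simp [hvc] <;> ring
    · cases hcv : c v <;> simp [hvc] <;> ring
  rw [Finset.sum_product, Finset.sum_congr rfl hterm, Finset.sum_add_distrib, ← Finset.sum_mul,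
    sum_attachProb_range hd ha hn, ← Finset.sum_filter,
    Finset.filter_mem_eq_inter, Finset.inter_eq_right.2 (cluster_subset_range hn),
    ← Finset.sum_mul, sum_attachProb_cluster hd c ha hn, stepMean, one_mul]

end BroadcastTree

namespace BroadcastTree

/-! ### One step of the random sequence -/

section RandomTree

variable {Ω : Type*} {par : ℕ → Ω → ℕ} {col : ℕ → Ω → Bool}

/-- The parents and the colours of the vertices of `T n`, as one random variable with values in a
countable type. -/
def history (par : ℕ → Ω → ℕ) (col : ℕ → Ω → Bool) (n : ℕ) (ω : Ω) :
    (Fin n → ℕ) × (Fin n → Bool) :=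
  -- `par 0` is not constrained by `stateEvent`; replacing it by a constant makes the fibres of
  -- `history` exactly the state events.
  (fun i => if i.1 = 0 then 0 else par i ω, fun i => col i ω)

/-- The number of vertices of the root cluster of `T n`. -/
def clusterSize (par : ℕ → Ω → ℕ) (col : ℕ → Ω → Bool) (n : ℕ) (ω : Ω) : ℕ :=
  (cluster (fun i => par i ω) (fun i => col i ω) n).card

/-- The total number of children of the vertices of the root cluster of `T n`. -/
def clusterChildren (par : ℕ → Ω → ℕ) (col : ℕ → Ω → Bool) (n : ℕ) (ω : Ω) : ℕ :=
  clusterDeg (fun i => par i ω) (fun i => col i ω) n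

lemma history_eq_iff {n : ℕ} {ω ω' : Ω} : history par col n ω = history par col n ω' ↔
    ω ∈ stateEvent par col n (fun i => par i ω') (fun i => col i ω') := by
  simp only [history, Prod.mk.injEq, funext_iff, stateEvent, Set.mem_ofPred_eq]
  refine and_congr ⟨fun h i h1 h2 => ?_, fun h i => ?_⟩ ⟨fun h i hi => h ⟨i, hi⟩, fun h i => h i i.2⟩
  · simpa [Nat.one_le_iff_ne_zero.1 h1] using h ⟨i, h2⟩
  · split_ifs with h0
    · rfl
    · exact h i (Nat.one_le_iff_ne_zero.2 h0) i.2

lemma history_preimage_singleton (n : ℕ) (ω : Ω) :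
    history par col n ⁻¹' {history par col n ω} =
      stateEvent par col n (fun i => par i ω) (fun i => col i ω) := by
  ext ω'
  exact history_eq_iff

lemma stateEvent_subset_of_le {m n : ℕ} (h : m ≤ n) (a : ℕ → ℕ) (c : ℕ → Bool) :
    stateEvent par col n a c ⊆ stateEvent par col m a c := fun _ hω =>
  ⟨fun i h1 h2 => hω.1 i h1 (h2.trans_le h), fun i h1 => hω.2 i (h1.trans_le h)⟩

lemma clusterSize_eq_of_mem {n : ℕ} {ω : Ω} (hlt : ∀ n, 1 ≤ n → par n ω < n) {a : ℕ → ℕ}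
    {c : ℕ → Bool} (h : ω ∈ stateEvent par col n a c) :
    clusterSize par col n ω = (cluster a c n).card := by
  rw [clusterSize, cluster_congr hlt h.1 h.2]

lemma clusterChildren_eq_of_mem {n : ℕ} {ω : Ω} (hlt : ∀ n, 1 ≤ n → par n ω < n) {a : ℕ → ℕ}
    {c : ℕ → Bool} (h : ω ∈ stateEvent par col n a c) :
    clusterChildren par col n ω = clusterDeg a c n :=
  clusterDeg_congr hlt h.1 h.2

lemma stateEvent_eq_biUnion {n : ℕ} (hn : 1 ≤ n) (hlt : ∀ n, 1 ≤ n → ∀ ω, par n ω < n) (a : ℕ → ℕ)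
    (c : ℕ → Bool) :
    stateEvent par col n a c = ⋃ x ∈ Finset.range n ×ˢ (Finset.univ : Finset Bool),
      stateEvent par col (n + 1) (Function.update a n x.1) (Function.update c n x.2) := by
  ext ω
  simp only [Set.mem_iUnion, Finset.mem_product, Finset.mem_range, Finset.mem_univ, and_true]
  constructor
  · intro h
    refine ⟨(par n ω, col n ω), hlt n hn ω, fun i h1 h2 => ?_, fun i hi => ?_⟩
    · rcases eq_or_ne i n with rfl | hin
      · simp
      · simpa [hin] using h.1 i h1 (by omega)
    · rcases eq_or_ne i n with rfl | hin
      · simp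
      · simpa [hin] using h.2 i (by omega)
  · rintro ⟨x, -, h⟩
    refine ⟨fun i h1 h2 => ?_, fun i hi => ?_⟩
    · simpa [h2.ne] using h.1 i h1 (by omega)
    · simpa [hi.ne] using h.2 i (by omega)

lemma pairwise_disjoint_stateEvent_update {n : ℕ} (hn : 1 ≤ n) (a : ℕ → ℕ) (c : ℕ → Bool) :
    Pairwise (Function.onFun Disjoint fun x : ℕ × Bool =>
      stateEvent par col (n + 1) (Function.update a n x.1) (Function.update c n x.2)) := by
  intro x y hxy
  refine Set.disjoint_left.2 fun ω h1 h2 => hxy ?_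
  have e1 := h1.1 n hn (Nat.lt_succ_self n)
  have e2 := h2.1 n hn (Nat.lt_succ_self n)
  have e3 := h1.2 n (Nat.lt_succ_self n)
  have e4 := h2.2 n (Nat.lt_succ_self n)
  simp only [Function.update_self] at e1 e2 e3 e4
  exact Prod.ext (e1.symm.trans e2) (e3.symm.trans e4)

lemma measurable_comap_of_factorsThrough {ι β : Type*} [MeasurableSpace ι]
    [DiscreteMeasurableSpace ι] [MeasurableSpace β] [Nonempty β] {Z : Ω → ι} {f : Ω → β}
    (hf : f.FactorsThrough Z) : Measurable[MeasurableSpace.comap Z inferInstance] f := by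
  have : f = Function.extend Z f (fun _ => Classical.arbitrary β) ∘ Z := by
    funext ω
    exact (hf.extend_apply _ ω).symm
  rw [this]
  exact (Measurable.of_discrete).comp (comap_measurable Z)

variable [MeasurableSpace Ω] {μ : Measure Ω} {α p : ℝ}

lemma IsBroadcastProcess.measurable_history (h : IsBroadcastProcess μ α p par col) (n : ℕ) :
    Measurable (history par col n) := by
  refine Measurable.prodMk (measurable_pi_lambda _ fun i => ?_)
    (measurable_pi_lambda _ fun i => h.measurable_col i)
  split_ifs
  · exact measurable_const
  · exact h.measurable_par i

/-- The σ-algebras generated by the coloured trees, starting from the first one. -/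
def IsBroadcastProcess.filtration (h : IsBroadcastProcess μ α p par col) :
    Filtration ℕ ‹MeasurableSpace Ω› where
  seq n := MeasurableSpace.comap (history par col (n + 1)) inferInstance
  mono' m n hmn := by
    have : history par col (m + 1) =
        (fun z : (Fin (n + 1) → ℕ) × (Fin (n + 1) → Bool) =>
          ((fun i => z.1 (Fin.castLE (by omega) i) : Fin (m + 1) → ℕ),
            (fun i => z.2 (Fin.castLE (by omega) i) : Fin (m + 1) → Bool))) ∘
          history par col (n + 1) := by
      rfl
    dsimp only
    rw [this, ← MeasurableSpace.comap_comp]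
    exact MeasurableSpace.comap_mono (Measurable.comap_le (Measurable.of_discrete))
  le' n := (h.measurable_history (n + 1)).comap_le

lemma IsBroadcastProcess.factorsThrough (h : IsBroadcastProcess μ α p par col) {β : Type*}
    (F : ℕ → ℕ → β) (n : ℕ) :
    (fun ω => F (clusterSize par col n ω) (clusterChildren par col n ω)).FactorsThrough
      (history par col n) := by
  intro ω ω' hω
  have h1 := history_eq_iff.1 hω
  have hlt : ∀ n, 1 ≤ n → par n ω < n := fun n hn => h.par_lt n hn ω
  simp only [clusterSize_eq_of_mem hlt h1, clusterChildren_eq_of_mem hlt h1]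
  rfl

lemma IsBroadcastProcess.measurable_comp (h : IsBroadcastProcess μ α p par col) {β : Type*}
    [MeasurableSpace β] [Nonempty β] (F : ℕ → ℕ → β) (n : ℕ) :
    Measurable fun ω => F (clusterSize par col n ω) (clusterChildren par col n ω) :=
  (measurable_comap_of_factorsThrough (h.factorsThrough F n)).mono
    (h.measurable_history n).comap_le le_rfl

lemma IsBroadcastProcess.measurableSet_stateEvent (h : IsBroadcastProcess μ α p par col) (n : ℕ)
    (a : ℕ → ℕ) (c : ℕ → Bool) : MeasurableSet (stateEvent par col n a c) := by
  have : stateEvent par col n a c =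
      (⋂ i, ⋂ (_ : 1 ≤ i), ⋂ (_ : i < n), par i ⁻¹' {a i}) ∩ ⋂ i, ⋂ (_ : i < n), col i ⁻¹' {c i} := by
    ext ω
    simp [stateEvent]
  rw [this]
  refine MeasurableSet.inter ?_ ?_
  · exact MeasurableSet.iInter fun i => MeasurableSet.iInter fun _ => MeasurableSet.iInter fun _ =>
      h.measurable_par i (measurableSet_singleton _)
  · exact MeasurableSet.iInter fun i => MeasurableSet.iInter fun _ =>
      h.measurable_col i (measurableSet_singleton _)

/-- At a fixed time both arguments of `F` are at most `n`, so only finitely many values occur. -/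
lemma IsBroadcastProcess.integrable_comp [IsFiniteMeasure μ]
    (h : IsBroadcastProcess μ α p par col) (F : ℕ → ℕ → ℝ) {n : ℕ} (hn : 1 ≤ n) :
    Integrable (fun ω => F (clusterSize par col n ω) (clusterChildren par col n ω)) μ := by
  refine Integrable.of_bound (h.measurable_comp F n).aestronglyMeasurable
    (∑ i ∈ Finset.range (n + 1), ∑ j ∈ Finset.range (n + 1), ‖F i j‖) (ae_of_all _ fun ω => ?_)
  have hK : clusterSize par col n ω ∈ Finset.range (n + 1) :=
    Finset.mem_range_succ_iff.2 (card_cluster_le hn)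
  have hD : clusterChildren par col n ω ∈ Finset.range (n + 1) :=
    Finset.mem_range_succ_iff.2 (clusterDeg_le (fun i hi => h.par_lt i hi ω) hn)
  refine (Finset.single_le_sum (f := fun j => ‖F (clusterSize par col n ω) j‖)
    (fun _ _ => norm_nonneg _) hD).trans ?_
  exact Finset.single_le_sum (f := fun i => ∑ j ∈ Finset.range (n + 1), ‖F i j‖)
    (fun _ _ => Finset.sum_nonneg fun _ _ => norm_nonneg _) hK

/-- Reduces a conditional expectation identity given a countably valued variable to its atoms. -/
lemma setIntegral_preimage_eq_of_atoms {ι : Type*} [Countable ι] [MeasurableSpace ι]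
    [MeasurableSingletonClass ι] {Z : Ω → ι} (hZ : Measurable Z) {f g : Ω → ℝ}
    (hf : Integrable f μ) (hg : Integrable g μ)
    (hfg : ∀ ω, ∫ x in Z ⁻¹' {Z ω}, f x ∂μ = ∫ x in Z ⁻¹' {Z ω}, g x ∂μ) (A : Set ι) :
    ∫ x in Z ⁻¹' A, f x ∂μ = ∫ x in Z ⁻¹' A, g x ∂μ := by
  have hA : Z ⁻¹' A = ⋃ z : A, Z ⁻¹' {z.1} := by
    ext ω
    simp
  have hd : Pairwise (Function.onFun Disjoint fun z : A => Z ⁻¹' {z.1}) := by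
    intro z z' hzz
    refine Disjoint.preimage _ (Set.disjoint_singleton.2 fun h => hzz (Subtype.ext h))
  have hm : ∀ z : A, MeasurableSet (Z ⁻¹' {z.1}) := fun z => hZ (measurableSet_singleton _)
  rw [hA, integral_iUnion hm hd hf.integrableOn, integral_iUnion hm hd hg.integrableOn]
  refine tsum_congr fun z => ?_
  by_cases hz : ∃ ω, Z ω = z.1
  · obtain ⟨ω, hω⟩ := hz
    rw [← hω]
    exact hfg ω
  · have : Z ⁻¹' {z.1} = ∅ := by
      ext ω
      simpa using fun h => hz ⟨ω, h⟩
    rw [this]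
    simp

lemma attachProb_congr {a a' : ℕ → ℕ} {n : ℕ} (ha : ∀ i, 1 ≤ i → i < n → a i = a' i) (v : ℕ) :
    attachProb α a n v = attachProb α a' n v := by
  simp only [attachProb, outdeg_congr ha]

/-! ### Transition law of the pair (size, total degree) -/

variable {d : ℕ}

lemma IsBroadcastProcess.measureReal_update (h : IsBroadcastProcess μ α p par col) {n : ℕ}
    (hn : 1 ≤ n) (a : ℕ → ℕ) (c : ℕ → Bool) {v : ℕ} (hv : v < n) (b : Bool) :
    μ.real (stateEvent par col (n + 1) (Function.update a n v) (Function.update c n b)) =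
      μ.real (stateEvent par col n a c) * (attachProb α a n v * if b = c v then p else 1 - p) := by
  rw [h.step n hn _ _ (by simpa using hv)]
  have h1 : stateEvent par col n (Function.update a n v) (Function.update c n b) =
      stateEvent par col n a c := by
    ext ω
    simp only [stateEvent, Set.mem_ofPred_eq]
    refine and_congr (forall_congr' fun i => forall_congr' fun _ => forall_congr' fun hi => ?_)
      (forall_congr' fun i => forall_congr' fun hi => ?_) <;> simp [hi.ne]
  rw [h1]
  simp only [Function.update_self]
  rw [attachProb_congr (a' := a) (fun i _ hi => by simp [hi.ne]), Function.update_of_ne hv.ne]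

lemma IsBroadcastProcess.setIntegral_stateEvent_succ [IsFiniteMeasure μ]
    (h : IsBroadcastProcess μ (-1 / (d : ℝ)) p par col) (hd : 1 ≤ d) {a : ℕ → ℕ} {c : ℕ → Bool}
    (ha : ∀ i, 1 ≤ i → a i < i) {n : ℕ} (hn : 1 ≤ n) (F : ℕ → ℕ → ℝ) :
    ∫ ω in stateEvent par col n a c,
        F (clusterSize par col (n + 1) ω) (clusterChildren par col (n + 1) ω) ∂μ =
      ∫ ω in stateEvent par col n a c,
        stepMean d p F n (clusterSize par col n ω) (clusterChildren par col n ω) ∂μ := by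
  have hconst : ∀ (m : ℕ) (G : ℕ → ℕ → ℝ) (a : ℕ → ℕ) (c : ℕ → Bool),
      ∫ ω in stateEvent par col m a c, G (clusterSize par col m ω) (clusterChildren par col m ω) ∂μ =
        μ.real (stateEvent par col m a c) * G (cluster a c m).card (clusterDeg a c m) := by
    intro m G a c
    rw [← smul_eq_mul, ← setIntegral_const]
    refine setIntegral_congr_fun (h.measurableSet_stateEvent m a c) fun ω hω => ?_
    have hlt : ∀ n, 1 ≤ n → par n ω < n := fun n hn => h.par_lt n hn ω
    simp only [clusterSize_eq_of_mem hlt hω, clusterChildren_eq_of_mem hlt hω]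
  rw [hconst n, ← sum_step_eq_stepMean hd p ha hn F, stateEvent_eq_biUnion hn h.par_lt a c,
    integral_biUnion_finset _ (fun x _ => h.measurableSet_stateEvent _ _ _)
      ((pairwise_disjoint_stateEvent_update hn a c).set_pairwise _)
      (fun x _ => (h.integrable_comp F (Nat.le_add_left 1 n)).integrableOn),
    ← stateEvent_eq_biUnion hn h.par_lt a c, Finset.mul_sum]
  refine Finset.sum_congr rfl fun x hx => ?_
  rw [Finset.mem_product, Finset.mem_range] at hx
  rw [hconst (n + 1), h.measureReal_update hn a c hx.1, mul_assoc]

lemma IsBroadcastProcess.setIntegral_succ [IsFiniteMeasure μ]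
    (h : IsBroadcastProcess μ (-1 / (d : ℝ)) p par col) (hd : 1 ≤ d) {n : ℕ} (hn : 1 ≤ n)
    (F : ℕ → ℕ → ℝ) (A : Set ((Fin n → ℕ) × (Fin n → Bool))) :
    ∫ ω in history par col n ⁻¹' A,
        F (clusterSize par col (n + 1) ω) (clusterChildren par col (n + 1) ω) ∂μ =
      ∫ ω in history par col n ⁻¹' A,
        stepMean d p F n (clusterSize par col n ω) (clusterChildren par col n ω) ∂μ := by
  refine setIntegral_preimage_eq_of_atoms (h.measurable_history n)
    (h.integrable_comp F (Nat.le_add_left 1 n)) (h.integrable_comp (stepMean d p F n) hn)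
    (fun ω => ?_) A
  rw [history_preimage_singleton]
  exact h.setIntegral_stateEvent_succ hd (fun i hi => h.par_lt i hi ω) hn F

lemma IsBroadcastProcess.integral_succ [IsFiniteMeasure μ]
    (h : IsBroadcastProcess μ (-1 / (d : ℝ)) p par col) (hd : 1 ≤ d) {n : ℕ} (hn : 1 ≤ n)
    (F : ℕ → ℕ → ℝ) :
    ∫ ω, F (clusterSize par col (n + 1) ω) (clusterChildren par col (n + 1) ω) ∂μ =
      ∫ ω, stepMean d p F n (clusterSize par col n ω) (clusterChildren par col n ω) ∂μ := by
  simpa using h.setIntegral_succ hd hn F Set.univ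

/-! ### Vertices have at most `d` children -/

/-- At the arrival of child number `d + 1` of `v`, the attachment factor is proportional to `d - d =
0`. -/
lemma IsBroadcastProcess.measureReal_stateEvent_of_lt_outdeg [IsFiniteMeasure μ]
    (h : IsBroadcastProcess μ (-1 / (d : ℝ)) p par col) (hd : 1 ≤ d) {a : ℕ → ℕ} (c : ℕ → Bool)
    (ha : ∀ i, 1 ≤ i → a i < i) {n v : ℕ} (hv : d < outdeg a n v) :
    μ.real (stateEvent par col n a c) = 0 := by
  induction n with
  | zero => simp [outdeg] at hv
  | succ n ih =>
    rcases Nat.eq_zero_or_pos n with rfl | hn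
    · simp [outdeg] at hv
    by_cases hvn : d < outdeg a n v
    · exact measureReal_mono_null (stateEvent_subset_of_le (Nat.le_succ n) a c) (ih hvn)
    · rw [outdeg_succ a hn] at hv
      split_ifs at hv with hav
      · have : outdeg a n v = d := by omega
        rw [h.step n hn a c (ha n hn), attachProb_eq hd ha hn, hav, this]
        simp
      · omega

lemma IsBroadcastProcess.ae_outdeg_le [IsFiniteMeasure μ]
    (h : IsBroadcastProcess μ (-1 / (d : ℝ)) p par col) (hd : 1 ≤ d) :
    ∀ᵐ ω ∂μ, ∀ n v, outdeg (fun i => par i ω) n v ≤ d := by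
  rw [ae_all_iff]
  intro n
  rw [ae_all_iff]
  intro v
  rw [ae_iff]
  set S := {ω | ¬ outdeg (fun i => par i ω) n v ≤ d} with hS
  have hsub : S ⊆ ⋃ z ∈ history par col n '' S, history par col n ⁻¹' {z} := by
    intro ω hω
    simp only [Set.mem_iUnion]
    exact ⟨_, Set.mem_image_of_mem _ hω, rfl⟩
  refine measure_mono_null hsub ((measure_biUnion_null_iff (Set.to_countable _)).2 ?_)
  rintro _ ⟨ω, hω, rfl⟩
  rw [history_preimage_singleton]
  refine (measureReal_eq_zero_iff (measure_ne_top _ _)).1 ?_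
  exact h.measureReal_stateEvent_of_lt_outdeg hd _ (fun i hi => h.par_lt i hi ω) (not_le.1 hω)

lemma IsBroadcastProcess.ae_clusterChildren_le [IsFiniteMeasure μ]
    (h : IsBroadcastProcess μ (-1 / (d : ℝ)) p par col) (hd : 1 ≤ d) :
    ∀ᵐ ω ∂μ, ∀ n, clusterChildren par col n ω ≤ d * clusterSize par col n ω := by
  filter_upwards [h.ae_outdeg_le hd] with ω hω n
  rw [clusterChildren, clusterDeg, clusterSize, mul_comm, ← smul_eq_mul]
  exact Finset.sum_le_card_nsmul _ _ _ fun v _ => hω n v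

end RandomTree

end BroadcastTree

namespace BroadcastTree

/-! ### The probability of a given final size of the root cluster -/

/-- For `N = w + d * j`: the number of paths from `w` to `0` with `j` steps `d - 1` and all other
steps `-1`, which are positive before their end. -/
noncomputable def pathCount (d N : ℕ) : ℕ → ℝ
  | 0 => 1
  | j + 1 => (N.choose (j + 1) : ℝ) - d * ((N - 1).choose j : ℝ)

/-- Decomposition by the first step, which amounts to Pascal's rule in both binomials. -/
lemma pathCount_succ (d : ℕ) {N : ℕ} (hN : 1 ≤ N) (j : ℕ) :
    pathCount d (N + 1) (j + 1) = pathCount d N j + pathCount d N (j + 1) := by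
  obtain ⟨M, rfl⟩ := Nat.exists_eq_add_of_le' hN
  cases j with
  | zero => simp [pathCount]; ring
  | succ i =>
    simp only [pathCount, Nat.add_sub_cancel]
    rw [Nat.choose_succ_succ (M + 1) (i + 1), Nat.choose_succ_succ M i]
    push_cast
    ring

/-- The case `w = 0`: a path already at `0` has no further steps. It supplies the zero boundary
values of `absorbProb`. -/
lemma pathCount_mul_self {d j : ℕ} (hd : 1 ≤ d) (hj : 1 ≤ j) : pathCount d (d * j) j = 0 := by
  obtain ⟨i, rfl⟩ := Nat.exists_eq_add_of_le' hj
  have hpos : 1 ≤ d * (i + 1) := Nat.mul_pos hd hj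
  have h := Nat.add_one_mul_choose_eq (d * (i + 1) - 1) i
  rw [Nat.sub_add_cancel hpos] at h
  have h' : (d : ℝ) * (i + 1) * ((d * (i + 1) - 1).choose i : ℝ) =
      ((d * (i + 1)).choose (i + 1) : ℝ) * (i + 1) := by exact_mod_cast h
  have hi : (i : ℝ) + 1 ≠ 0 := by positivity
  rw [pathCount]
  apply mul_right_cancel₀ hi
  linear_combination -h'

lemma pathCount_mul_pred (d : ℕ) {k : ℕ} (hd : 1 ≤ d) (hk : 1 ≤ k) :
    pathCount d (d * k) (k - 1) = 1 / (k : ℝ) * ((k * d).choose (k - 1) : ℝ) := by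
  obtain ⟨i, rfl⟩ := Nat.exists_eq_add_of_le' hk
  cases i with
  | zero => simp [pathCount]
  | succ j =>
    have hpos : 1 ≤ d * (j + 1 + 1) := Nat.mul_pos hd hk
    have h := Nat.add_one_mul_choose_eq (d * (j + 1 + 1) - 1) j
    rw [Nat.sub_add_cancel hpos] at h
    have h' : (d : ℝ) * (j + 1 + 1) * ((d * (j + 1 + 1) - 1).choose j : ℝ) =
        ((d * (j + 1 + 1)).choose (j + 1) : ℝ) * (j + 1) := by exact_mod_cast h
    rw [Nat.add_sub_cancel, pathCount, mul_comm (j + 1 + 1) d]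
    push_cast
    have hj : (j : ℝ) + 1 + 1 ≠ 0 := by positivity
    field_simp
    linear_combination -h'

/-- The probability that the root cluster stops growing with `k` vertices, given that it has `K`
vertices with `D` children in total. -/
noncomputable def absorbProb (d : ℕ) (p : ℝ) (k K D : ℕ) : ℝ :=
  if K ≤ k ∧ D ≤ d * k then
    pathCount d (d * k - D) (k - K) * p ^ (k - K) * (1 - p) ^ (d * k - D - (k - K))
  else 0

lemma absorbProb_of_lt (d : ℕ) (p : ℝ) {k K : ℕ} (h : k < K) (D : ℕ) :
    absorbProb d p k K D = 0 :=
  if_neg fun h' => absurd h'.1 (not_le.2 h)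

lemma absorbProb_self (d : ℕ) (p : ℝ) (k : ℕ) : absorbProb d p k k (d * k) = 1 := by
  simp [absorbProb, pathCount]

lemma absorbProb_mul_of_ne {d : ℕ} (hd : 1 ≤ d) (p : ℝ) {k K : ℕ} (h : K ≠ k) :
    absorbProb d p k K (d * K) = 0 := by
  rcases lt_or_gt_of_ne h with h | h
  · rw [absorbProb, ← Nat.mul_sub, pathCount_mul_self hd (by omega)]
    simp
  · exact absorbProb_of_lt d p h _

/-- First-step analysis of the walk while free places remain. If `K = k`, only down-steps are left.
-/
lemma absorbProb_eq {d : ℕ} (hd : 2 ≤ d) (p : ℝ) (k : ℕ) {K D : ℕ} (h : D < d * K) :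
    absorbProb d p k K D =
      p * absorbProb d p k (K + 1) (D + 1) + (1 - p) * absorbProb d p k K (D + 1) := by
  rcases lt_or_ge k K with hk | hk
  · simp [absorbProb_of_lt d p hk, absorbProb_of_lt d p (hk.trans (Nat.lt_succ_self K))]
  obtain ⟨j, rfl⟩ := Nat.exists_eq_add_of_le hk
  obtain ⟨w, hw⟩ := Nat.exists_eq_add_of_lt h
  cases j with
  | zero =>
    rw [absorbProb_of_lt d p (by omega : K + 0 < K + 1), absorbProb, absorbProb,
      if_pos ⟨le_rfl, h.le⟩, if_pos ⟨le_rfl, h⟩]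
    have e1 : d * (K + 0) - D = w + 1 := by simp only [add_zero]; omega
    have e2 : d * (K + 0) - (D + 1) = w := by simp only [add_zero]; omega
    simp only [e1, e2, Nat.add_sub_cancel_left, pathCount]
    simp [pow_succ']
  | succ j =>
    -- `M` is the number of steps left after the next one; `j + 1 ≤ M` keeps the truncated exponents
    -- of `1 - p` honest.
    obtain ⟨M, hM⟩ : ∃ M, M = w + d * (j + 1) := ⟨_, rfl⟩
    have hMj : j + 1 ≤ M := by nlinarith
    have hdk : d * (K + (j + 1)) = D + M + 1 := by rw [mul_add, hw, hM]; ring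
    rw [absorbProb, absorbProb, absorbProb, hdk, if_pos ⟨by omega, by omega⟩,
      if_pos ⟨by omega, by omega⟩, if_pos ⟨by omega, by omega⟩]
    have e1 : D + M + 1 - D = M + 1 := by omega
    have e2 : D + M + 1 - (D + 1) = M := by omega
    have e3 : K + (j + 1) - K = j + 1 := by omega
    have e4 : K + (j + 1) - (K + 1) = j := by omega
    have e5 : M + 1 - (j + 1) = M - (j + 1) + 1 := by omega
    have e6 : M - j = M - (j + 1) + 1 := by omega
    rw [e1, e2, e3, e4, e5, e6, pathCount_succ d (by omega)]
    ring

/-- Harmonicity for the jump walk survives any holding probability, and at `D = dK` the rate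
vanishes. -/
lemma stepMean_absorbProb {d : ℕ} (hd : 2 ≤ d) (p : ℝ) (k n : ℕ) {K D : ℕ} (h : D ≤ d * K) :
    stepMean d p (absorbProb d p k) n K D = absorbProb d p k K D := by
  rcases h.lt_or_eq with h | h
  · rw [stepMean, ← absorbProb_eq hd p k h, sub_self, mul_zero, add_zero]
  · have : rate d n K D = 0 := by rw [rate, h]; simp
    rw [stepMean, this, zero_mul, add_zero]

lemma exists_norm_absorbProb_le (d : ℕ) (p : ℝ) (k : ℕ) :
    ∃ C, ∀ K D, ‖absorbProb d p k K D‖ ≤ C := by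
  refine ⟨∑ x ∈ Finset.range (k + 1) ×ˢ Finset.range (d * k + 1), ‖absorbProb d p k x.1 x.2‖,
    fun K D => ?_⟩
  by_cases h : K ≤ k ∧ D ≤ d * k
  · exact Finset.single_le_sum (f := fun x : ℕ × ℕ => ‖absorbProb d p k x.1 x.2‖)
      (fun _ _ => norm_nonneg _) (a := (K, D)) (by simp; omega)
  · rw [absorbProb, if_neg h, norm_zero]
    exact Finset.sum_nonneg fun _ _ => norm_nonneg _

/-! ### Convergence -/

lemma rate_nonneg {d : ℕ} (hd : 1 ≤ d) (n : ℕ) {K D : ℕ} (h : D ≤ d * K) : 0 ≤ rate d n K D := by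
  refine div_nonneg ?_ (rate_den_pos hd n).le
  rw [sub_nonneg]
  exact_mod_cast h

lemma le_rate {d : ℕ} (hd : 1 ≤ d) {n : ℕ} (hn : 1 ≤ n) {K D : ℕ} (h : D < d * K) :
    1 / ((d : ℝ) * n) ≤ rate d n K D := by
  have h1 : (D : ℝ) + 1 ≤ d * K := by exact_mod_cast h
  have h2 : (1 : ℝ) ≤ n := by exact_mod_cast hn
  exact div_le_div₀ (by linarith) (by linarith) (rate_den_pos hd n) (by linarith)

section RandomTree

variable {Ω : Type*} {par : ℕ → Ω → ℕ} {col : ℕ → Ω → Bool}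

lemma clusterSize_mono (ω : Ω) : Monotone fun n => clusterSize par col n ω :=
  card_cluster_mono _ _

lemma clusterSize_one (ω : Ω) : clusterSize par col 1 ω = 1 := by
  rw [clusterSize, cluster_one, Finset.card_singleton]

lemma clusterChildren_one (ω : Ω) : clusterChildren par col 1 ω = 0 :=
  clusterDeg_one _ _

lemma clusterChildren_mono {ω : Ω} (hlt : ∀ n, 1 ≤ n → par n ω < n) :
    Monotone fun n => clusterChildren par col n ω := by
  refine monotone_nat_of_le_succ fun n => ?_
  rcases Nat.eq_zero_or_pos n with rfl | hn
  · simp [clusterChildren, clusterDeg, outdeg]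
  · simp only [clusterChildren, clusterDeg_succ hlt hn]
    exact Nat.le_add_right _ _

lemma exists_eventually_eq_of_monotone {f : ℕ → ℕ} (hf : Monotone f) {b : ℕ}
    (hb : ∀ᶠ n in atTop, f n ≤ b) : ∃ c, ∀ᶠ n in atTop, f n = c := by
  rcases tendsto_atTop_of_monotone hf with h | ⟨c, h⟩
  · obtain ⟨n, h1, h2⟩ := (hb.and (h.eventually_ge_atTop (b + 1))).exists
    omega
  · exact ⟨c, by simpa [nhds_discrete, tendsto_pure] using h⟩

variable [MeasurableSpace Ω] {μ : Measure Ω} {p : ℝ} {d : ℕ}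

/-- On the stalled event the chance that `D` is exceeded is at least `1/(dn)` at each time `n`. The
probabilities of having exceeded `D` would then grow by at least a multiple of the harmonic series,
yet they are bounded by `1`. -/
lemma IsBroadcastProcess.measure_forall_eq [IsProbabilityMeasure μ]
    (h : IsBroadcastProcess μ (-1 / (d : ℝ)) p par col) (hd : 1 ≤ d) {K D : ℕ} (hKD : D < d * K)
    {N : ℕ} (hN : 1 ≤ N) :
    μ {ω | ∀ n, N ≤ n → clusterSize par col n ω = K ∧ clusterChildren par col n ω = D} = 0 := by
  set E := {ω | ∀ n, N ≤ n → clusterSize par col n ω = K ∧ clusterChildren par col n ω = D} with hE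
  have hEm : MeasurableSet E := by
    have : E = ⋂ n, ⋂ (_ : N ≤ n),
        {ω | clusterSize par col n ω = K ∧ clusterChildren par col n ω = D} := by
      ext ω
      simp [hE]
    rw [this]
    exact MeasurableSet.iInter fun n => MeasurableSet.iInter fun _ =>
      measurableSet_setOfPred.2 (h.measurable_comp (fun i j => i = K ∧ j = D) n)
  let F : ℕ → ℕ → ℝ := fun _ j => if D < j then 1 else 0
  let e : ℕ → ℝ := fun n => ∫ ω, F (clusterSize par col n ω) (clusterChildren par col n ω) ∂μ
  have hstep : ∀ n, N ≤ n → e n + μ.real E / (d * n) ≤ e (n + 1) := by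
    intro n hn
    have hn1 : 1 ≤ n := hN.trans hn
    have h1 : e n + μ.real E / (d * n) =
        ∫ ω, (F (clusterSize par col n ω) (clusterChildren par col n ω) +
          E.indicator (fun _ => 1 / ((d : ℝ) * n)) ω) ∂μ := by
      rw [integral_add (h.integrable_comp F hn1) ((integrable_const _).indicator hEm),
        integral_indicator_const _ hEm, smul_eq_mul, mul_one_div]
    rw [h1]
    simp only [e]
    rw [h.integral_succ hd hn1 F]
    refine integral_mono_ae
      ((h.integrable_comp F hn1).add ((integrable_const _).indicator hEm))
      (h.integrable_comp (stepMean d p F n) hn1) ?_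
    filter_upwards [h.ae_clusterChildren_le hd] with ω hω
    -- `F` ignores the size, so both colour outcomes contribute alike and `p + (1 - p) = 1`.
    have hF : ∀ K' D', stepMean d p F n K' D' =
        F K' D' + rate d n K' D' * if D' = D then 1 else 0 := by
      intro K' D'
      simp only [stepMean, F]
      congr 2
      rcases lt_trichotomy D' D with h | h | h
      · rw [if_neg (by omega), if_neg (by omega), if_neg (by omega)]; ring
      · rw [if_pos (by omega), if_neg (by omega), if_pos (by omega)]; ring
      · rw [if_pos (by omega), if_pos (by omega), if_neg (by omega)]; ring
    rw [hF]
    gcongr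
    by_cases hωE : ω ∈ E
    · rw [Set.indicator_of_mem hωE, (hωE n hn).1, (hωE n hn).2]
      simpa using le_rate hd hn1 hKD
    · rw [Set.indicator_of_notMem hωE]
      have := rate_nonneg hd n (hω n)
      positivity
  have he0 : ∀ n, 0 ≤ e n := fun n => integral_nonneg fun ω => by
    simp only [F, Pi.zero_apply]; split_ifs <;> norm_num
  have he1 : ∀ n, 1 ≤ n → e n ≤ 1 := by
    intro n hn
    refine (integral_mono (h.integrable_comp F hn) (integrable_const 1) fun ω => ?_).trans (by simp)
    simp only [F]; split_ifs <;> norm_num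
  have hsum : ∀ m, ∑ i ∈ Finset.range m, μ.real E / (d * ((i + N : ℕ) : ℝ)) ≤ e (m + N) - e N := by
    intro m
    induction m with
    | zero => simp
    | succ m ih =>
      rw [Finset.sum_range_succ]
      have := hstep (m + N) (Nat.le_add_left _ _)
      rw [show m + 1 + N = m + N + 1 by ring]
      linarith
  have hS : Summable fun i : ℕ => μ.real E / (d * ((i + N : ℕ) : ℝ)) :=
    summable_of_sum_range_le (c := 1) (fun i => by positivity) fun m =>
      (hsum m).trans (by linarith [he0 N, he1 (m + N) (by omega)])
  by_contra hne
  have hr : μ.real E ≠ 0 := fun h0 => hne ((measureReal_eq_zero_iff (measure_ne_top _ _)).1 h0)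
  have hd0 : (d : ℝ) ≠ 0 := by positivity
  refine Real.not_summable_natCast_inv
    ((summable_nat_add_iff (f := fun n : ℕ => (n : ℝ)⁻¹) N).1 ?_)
  refine (hS.mul_left (d / μ.real E)).congr fun i => ?_
  have : ((i + N : ℕ) : ℝ) ≠ 0 := by
    have : i + N ≠ 0 := by omega
    exact_mod_cast this
  field_simp

lemma IsBroadcastProcess.ae_not_eventually_eq [IsProbabilityMeasure μ]
    (h : IsBroadcastProcess μ (-1 / (d : ℝ)) p par col) (hd : 1 ≤ d) :
    ∀ᵐ ω ∂μ, ∀ K D, D < d * K →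
      ¬ ∀ᶠ n in atTop, clusterSize par col n ω = K ∧ clusterChildren par col n ω = D := by
  have key : ∀ᵐ ω ∂μ, ∀ K D N, D < d * K → 1 ≤ N →
      ¬ ∀ n, N ≤ n → clusterSize par col n ω = K ∧ clusterChildren par col n ω = D := by
    simp only [ae_all_iff]
    intro K D N hKD hN
    rw [ae_iff]
    simpa only [not_not] using h.measure_forall_eq hd hKD hN
  filter_upwards [key] with ω hω K D hKD hev
  obtain ⟨N, hN⟩ := eventually_atTop.1 hev
  exact hω K D (N + 1) hKD (Nat.le_add_left 1 N) fun n hn => hN n (by omega)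

/-- If the size stabilises at `c`, the degree is bounded by `dc`, hence stabilises too, and only
`dc` is possible without stalling. If the size diverges, it passes `k` and the value becomes `0`. -/
lemma IsBroadcastProcess.ae_tendsto_absorbProb [IsProbabilityMeasure μ]
    (h : IsBroadcastProcess μ (-1 / (d : ℝ)) p par col) (hd : 1 ≤ d) (k : ℕ) :
    ∀ᵐ ω ∂μ, Tendsto (fun n => absorbProb d p k (clusterSize par col n ω)
        (clusterChildren par col n ω)) atTop
      (𝓝 ({ω | ∀ᶠ n in atTop, clusterSize par col n ω = k}.indicator (fun _ => (1 : ℝ)) ω)) := by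
  filter_upwards [h.ae_clusterChildren_le hd, h.ae_not_eventually_eq hd] with ω hle hev
  have hlt : ∀ n, 1 ≤ n → par n ω < n := fun n hn => h.par_lt n hn ω
  by_cases hb : ∃ c, ∀ᶠ n in atTop, clusterSize par col n ω = c
  · obtain ⟨c, hc⟩ := hb
    obtain ⟨D, hD⟩ := exists_eventually_eq_of_monotone
      (clusterChildren_mono (col := col) hlt) (b := d * c) <| by
        filter_upwards [hc] with n hn
        exact hn ▸ hle n
    have hDc : D = d * c := by
      obtain ⟨n, h1, h2⟩ := (hc.and hD).exists
      have h3 := hle n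
      rw [h1, h2] at h3
      exact h3.eq_of_not_lt fun hlt => hev c D hlt (hc.and hD)
    refine tendsto_const_nhds.congr' ?_
    filter_upwards [hc, hD] with n h1 h2
    rw [h1, h2, hDc]
    rcases eq_or_ne c k with rfl | hck
    · rw [absorbProb_self,
        Set.indicator_of_mem (show ω ∈ {ω | ∀ᶠ n in atTop, clusterSize par col n ω = c} from hc)]
    · rw [absorbProb_mul_of_ne hd p hck, Set.indicator_of_notMem]
      intro hk
      obtain ⟨n, h1, h2⟩ := (hc.and hk).exists
      exact hck (h1.symm.trans h2)
  · have hk : ω ∉ {ω | ∀ᶠ n in atTop, clusterSize par col n ω = k} := fun hk => hb ⟨k, hk⟩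
    rw [Set.indicator_of_notMem hk]
    rcases tendsto_atTop_of_monotone (clusterSize_mono (par := par) (col := col) ω) with ht | ⟨c, hc⟩
    · refine tendsto_const_nhds.congr' ?_
      filter_upwards [ht.eventually_ge_atTop (k + 1)] with n hn
      rw [absorbProb_of_lt d p hn]
    · exact absurd ⟨c, by simpa [nhds_discrete, tendsto_pure] using hc⟩ hb

lemma IsBroadcastProcess.measureReal_eventually_clusterSize_eq [IsProbabilityMeasure μ]
    (h : IsBroadcastProcess μ (-1 / (d : ℝ)) p par col) (hd : 2 ≤ d) (k : ℕ) :
    μ.real {ω | ∀ᶠ n in atTop, clusterSize par col n ω = k} = absorbProb d p k 1 0 := by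
  have hd1 : 1 ≤ d := by omega
  have hm : MeasurableSet {ω | ∀ᶠ n in atTop, clusterSize par col n ω = k} := by
    simp only [eventually_atTop, Set.ofPred_exists, Set.ofPred_forall]
    exact MeasurableSet.iUnion fun N => MeasurableSet.iInter fun n => MeasurableSet.iInter fun _ =>
      measurableSet_setOfPred.2 (h.measurable_comp (fun i _ => i = k) n)
  obtain ⟨C, hC⟩ := exists_norm_absorbProb_le d p k
  have hlim := tendsto_integral_of_dominated_convergence (μ := μ) (fun _ => C)
    (fun n => (h.measurable_comp (absorbProb d p k) n).aestronglyMeasurable) (integrable_const C)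
    (fun n => ae_of_all _ fun ω => hC _ _) (h.ae_tendsto_absorbProb hd1 k)
  have hconst : ∀ n, 1 ≤ n → ∫ ω, absorbProb d p k (clusterSize par col n ω)
      (clusterChildren par col n ω) ∂μ = absorbProb d p k 1 0 := by
    intro n hn
    induction n, hn using Nat.le_induction with
    | base => simp [clusterSize_one, clusterChildren_one]
    | succ n hn ih =>
      rw [h.integral_succ hd1 hn, ← ih]
      refine integral_congr_ae ?_
      filter_upwards [h.ae_clusterChildren_le hd1] with ω hω
      exact stepMean_absorbProb hd p k n (hω n)
  rw [integral_indicator_const _ hm, smul_eq_mul, mul_one] at hlim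
  refine tendsto_nhds_unique hlim (tendsto_const_nhds.congr' ?_)
  filter_upwards [eventually_ge_atTop 1] with n hn
  exact (hconst n hn).symm

/-! ### Almost sure finiteness -/

/-- The number of free places at the root cluster. -/
noncomputable def freePlaces (d K D : ℕ) : ℝ := (d : ℝ) * K - D

lemma freePlaces_nonneg {d K D : ℕ} (h : D ≤ d * K) : 0 ≤ freePlaces d K D := by
  rw [freePlaces, sub_nonneg]
  exact_mod_cast h

/-- The drift is `rate * (p * d - 1)`, which is at most `0`. -/
lemma IsBroadcastProcess.supermartingale_freePlaces [IsProbabilityMeasure μ]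
    (h : IsBroadcastProcess μ (-1 / (d : ℝ)) p par col) (hd : 1 ≤ d) (hp : p * d ≤ 1) :
    Supermartingale (fun n ω => freePlaces d (clusterSize par col (n + 1) ω)
      (clusterChildren par col (n + 1) ω)) h.filtration μ := by
  refine supermartingale_of_setIntegral_succ_le (fun n => ?_)
    (fun n => h.integrable_comp _ (Nat.le_add_left 1 n)) ?_
  · exact (measurable_comap_of_factorsThrough (h.factorsThrough _ _)).stronglyMeasurable
  · rintro n _ ⟨A, -, rfl⟩
    rw [h.setIntegral_succ hd (Nat.le_add_left 1 n)]
    refine setIntegral_mono_ae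
      (h.integrable_comp (stepMean d p (freePlaces d) (n + 1)) (Nat.le_add_left 1 n)).integrableOn
      (h.integrable_comp (freePlaces d) (Nat.le_add_left 1 n)).integrableOn ?_
    filter_upwards [h.ae_clusterChildren_le hd] with ω hω
    have h1 := rate_nonneg hd (n + 1) (hω (n + 1))
    have h2 : ∀ K D : ℕ, p * freePlaces d (K + 1) (D + 1) + (1 - p) * freePlaces d K (D + 1) -
        freePlaces d K D = p * d - 1 := by
      intro K D
      simp only [freePlaces]
      push_cast
      ring
    rw [stepMean, h2]
    nlinarith

lemma IsBroadcastProcess.ae_exists_eventually_clusterSize_eq [IsProbabilityMeasure μ]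
    (h : IsBroadcastProcess μ (-1 / (d : ℝ)) p par col) (hd : 2 ≤ d) (hp : p * d ≤ 1) :
    ∀ᵐ ω ∂μ, ∃ k, ∀ᶠ n in atTop, clusterSize par col n ω = k := by
  have hd1 : 1 ≤ d := by omega
  have hM := h.supermartingale_freePlaces hd1 hp
  -- By nonnegativity the L¹ norm is the mean, which never exceeds the initial value `d`.
  have hbdd : ∀ n, eLpNorm ((-fun n ω => freePlaces d (clusterSize par col (n + 1) ω)
      (clusterChildren par col (n + 1) ω)) n) 1 μ ≤ (d : NNReal) := by
    intro n
    have hle := hM.setIntegral_le (Nat.zero_le n) MeasurableSet.univ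
    simp only [Measure.restrict_univ, zero_add, clusterSize_one, clusterChildren_one] at hle
    rw [Pi.neg_apply, eLpNorm_neg, eLpNorm_one_eq_lintegral_enorm,
      ← ofReal_integral_norm_eq_lintegral_enorm (h.integrable_comp _ (Nat.le_add_left 1 n)),
      integral_congr_ae (g := fun ω => freePlaces d (clusterSize par col (n + 1) ω)
        (clusterChildren par col (n + 1) ω))]
    · refine (ENNReal.ofReal_le_ofReal hle).trans ?_
      simp [freePlaces]
    · filter_upwards [h.ae_clusterChildren_le hd1] with ω hω
      exact Real.norm_of_nonneg (freePlaces_nonneg (hω _))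
  filter_upwards [hM.neg.exists_ae_tendsto_of_bdd hbdd] with ω ⟨c, hc⟩
  have hdiff := (hc.comp (tendsto_add_atTop_nat 1)).sub hc
  rw [sub_self] at hdiff
  -- Increments of absolute value below `1` exclude an up-step of size `d - 1`; this is where `2 ≤
  -- d` enters.
  have hev := hdiff.eventually (Ioo_mem_nhds (show (-1 : ℝ) < 0 by norm_num) one_pos)
  obtain ⟨N, hN⟩ := eventually_atTop.1 hev
  refine ⟨clusterSize par col (N + 1) ω, eventually_atTop.2 ⟨N + 1, fun n hn => ?_⟩⟩
  induction n, hn using Nat.le_induction with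
  | base => rfl
  | succ n hn ih =>
    rw [← ih]
    obtain ⟨m, rfl⟩ := Nat.exists_eq_add_of_le' (show 1 ≤ n by omega)
    obtain ⟨h1, h2⟩ := hN m (by omega)
    simp only [Function.comp_apply, Pi.neg_apply, freePlaces, clusterChildren,
      clusterDeg_succ (fun i hi => h.par_lt i hi ω) (Nat.le_add_left 1 m)] at h1 h2
    simp only [clusterSize, card_cluster_succ (Nat.le_add_left 1 m)] at h1 h2 ⊢
    have hd2 : (2 : ℝ) ≤ d := by exact_mod_cast hd
    split_ifs at h1 h2 ⊢ with h3 h4 h4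
    · push_cast at h1 h2
      linarith
    · exact absurd h3.1 h4
    · rfl
    · rfl

end RandomTree

end BroadcastTree

theorem corollary2p9 {Ω : Type*} [MeasurableSpace Ω] (μ : Measure Ω) [IsProbabilityMeasure μ]
    (d : ℕ) (hd : 2 ≤ d) (p : ℝ) (hp0 : 0 ≤ p) (hp1 : p ≤ 1)
    (par : ℕ → Ω → ℕ) (col : ℕ → Ω → Bool)
    (h : BroadcastTree.IsBroadcastProcess μ (-1 / (d : ℝ)) p par col) :
    (∀ k : ℕ, 1 ≤ k →
      μ.real {ω | Tendsto
          (fun n => (BroadcastTree.rootCluster (fun i => par i ω) (fun i => col i ω) n).ncard)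
          atTop (𝓝 k)} =
        1 / (k : ℝ) * ((k * d).choose (k - 1) : ℝ) * p ^ (k - 1) * (1 - p) ^ (k * d - k + 1)) ∧
    (p ≤ 1 / (d : ℝ) →
      ∀ᵐ ω ∂μ, ∃ k : ℕ, Tendsto
        (fun n => (BroadcastTree.rootCluster (fun i => par i ω) (fun i => col i ω) n).ncard)
        atTop (𝓝 k)) := by
  have hiff : ∀ (ω : Ω) (k : ℕ), Tendsto
      (fun n => (BroadcastTree.rootCluster (fun i => par i ω) (fun i => col i ω) n).ncard)
      atTop (𝓝 k) ↔ ∀ᶠ n in atTop, BroadcastTree.clusterSize par col n ω = k := by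
    intro ω k
    simp_rw [BroadcastTree.ncard_rootCluster (fun i hi => h.par_lt i hi ω)]
    rw [nhds_discrete, tendsto_pure]
    rfl
  simp_rw [hiff]
  refine ⟨fun k hk => ?_, fun hp => ?_⟩
  · rw [h.measureReal_eventually_clusterSize_eq hd, BroadcastTree.absorbProb,
      if_pos ⟨hk, Nat.zero_le _⟩, Nat.sub_zero, BroadcastTree.pathCount_mul_pred d (by omega) hk]
    have : k ≤ k * d := Nat.le_mul_of_pos_right k (by omega)
    rw [mul_comm d k, show k * d - (k - 1) = k * d - k + 1 by omega]
  · refine h.ae_exists_eventually_clusterSize_eq hd ?_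
    have hd0 : (0 : ℝ) < d := by positivity
    exact (le_div_iff₀ hd0).1 hp
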